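/- Let $A=\bigoplus_{j\ge 0}A_j$ be a commutative graded $\mathbb Z$-algebra with identity such that each $A_j$ is a free abelian group of finite rank. For a finite graph $G$ (loops and multiple edges allowed) with an ordered edge set $E$, let $C^i(G)=\bigoplus_{s\subseteq E,\ |s|=i}C^s(G)$, where $C^s(G)$ is the tensor product over $\mathbb Z$ of copies of $A$, one for each connected component of the graph $[G:s]$ with vertex set $V(G)$ and edge set $s$, with the grading induced from $A$. Let $d^i:C^i(G)\to C^{i+1}(G)$ be the sum, over all $s$ with $|s|=i$ and all $e\in E\setminus s$, of $(-1)^{|\{f\in s\,:\,f<e\}|}$ times the map $C^s(G)\to C^{s\cup\{e\}}(G)$ that multiplies the two tensor factors of the components joined by $e$ and is the identity on the other factors (and is the identity if $e$ joins a component to itself). Let $H^i_A(G)=\ker d^i/\operatorname{im} d^{i-1}$ for $i\ge 0$ (with $d^{-1}=0$), a graded abelian group. For $n\ge 1$ let $P_n$ be the polygon with $n$ vertices and $n$ edges ($P_1$ is one vertex with a loop, $P_2$ is two vertices joined by two edges). Then: 1. For all $n\ge 1$ and $i\ge 1$ there is an isomorphism of graded abelian groups $H_A^{i+1}(P_{n+1})\cong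 H_A^{i}(P_n)$. 2. For all $n\ge 1$ and $1\le i\le n$ there is an isomorphism of graded abelian groups $H_A^{i}(P_n)\cong H_A^{1}(P_{n-i+1})$, and $H_A^{i}(P_n)=0$ for $i>n$. -/

import Mathlib

open scoped Graph TensorProduct

namespace GraphCohomology

noncomputable section

/-! ### Tensor powers of a commutative algebra and multiplication along a map of index sets -/

section Merge

variable (R : Type*) [CommRing R] (A : Type*) [CommRing A] [Algebra R A]
variable {ι κ : Type*} [Fintype ι] [DecidableEq κ]

/-- The `R`-linear map `A^{⊗ ι} → A^{⊗ κ}` induced by a map `f : ι → κ`: it multiplies together the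
tensor factors that `f` sends to the same index. See `merge_tprod` for the formula on pure tensors.
-/
def merge (f : ι → κ) : (⨂[R] _ : ι, A) →ₗ[R] (⨂[R] _ : κ, A) :=
  PiTensorProduct.lift
    ((MultilinearMap.mkPiAlgebra R ι (⨂[R] _ : κ, A)).compLinearMap fun c =>
      (PiTensorProduct.singleAlgHom (R := R) (A := fun _ : κ => A) (f c)).toLinearMap)

/-- On pure tensors, `merge f (⊗_c a_c) = ⊗_k ∏_{f c = k} a_c`. -/
theorem merge_tprod (f : ι → κ) (a : ι → A) :
    merge R A f (PiTensorProduct.tprod R a) =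
      PiTensorProduct.tprod R fun k => ∏ c with f c = k, a c := by
  simp only [merge, PiTensorProduct.lift.tprod, MultilinearMap.compLinearMap_apply,
    MultilinearMap.mkPiAlgebra_apply, AlgHom.toLinearMap_apply]
  have h : ∀ c, (PiTensorProduct.singleAlgHom (R := R) (A := fun _ : κ => A) (f c)) (a c) =
      PiTensorProduct.tprod R (MonoidHom.mulSingle (fun _ : κ => A) (f c) (a c)) := fun c => rfl
  simp only [h]
  rw [← PiTensorProduct.tprod_prod]
  congr 1
  funext k
  rw [Finset.prod_apply, Finset.prod_filter]
  refine Finset.prod_congr rfl fun c _ => ?_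
  simp only [MonoidHom.mulSingle_apply, Pi.mulSingle_apply]
  simp [eq_comm]

theorem merge_merge [Fintype κ] {l : Type*} [DecidableEq l] (f : ι → κ) (g : κ → l) (x : ⨂[R] _ : ι, A) :
    merge R A g (merge R A f x) = merge R A (g ∘ f) x := by
  suffices h : merge R A g ∘ₗ merge R A f = merge R A (g ∘ f) from LinearMap.congr_fun h x
  ext a
  simp only [LinearMap.compMultilinearMap_apply, LinearMap.comp_apply, merge_tprod]
  congr 1
  funext k
  rw [← Finset.prod_fiberwise_of_maps_to (s := Finset.univ.filter fun c => (g ∘ f) c = k)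
    (t := Finset.univ.filter fun c => g c = k) (g := f) (by simp)]
  refine Finset.prod_congr rfl fun c hc => Finset.prod_congr ?_ fun _ _ => rfl
  ext y
  simp only [Finset.mem_filter, Finset.mem_univ, true_and] at hc ⊢
  constructor
  · rintro rfl
    exact ⟨hc, rfl⟩
  · exact fun h => h.2

end Merge

/-! ### The cochain complex of a finite graph with linearly ordered edges -/

section Complex

set_option linter.unusedSectionVars false

variable {α β : Type*}

/-- The set of connected components of `[G : s]`, the graph with the vertices of `G` and with edge
set `s`: vertices modulo the equivalence relation generated by being joined by an edge of `s`. -/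
def Component (G : Graph α β) (s : Finset β) : Type _ :=
  Quot fun x y : V(G) => ∃ e ∈ s, G.IsLink e x y

instance [Finite α] (G : Graph α β) (s : Finset β) : Finite (Component G s) :=
  inferInstanceAs (Finite (Quot _))

instance [Finite α] (G : Graph α β) (s : Finset β) : Fintype (Component G s) := Fintype.ofFinite _

instance (G : Graph α β) (s : Finset β) : DecidableEq (Component G s) := Classical.decEq _

/-- For `s ⊆ t`, the component of `[G : t]` that contains a given component of `[G : s]`. -/
def Component.map (G : Graph α β) {s t : Finset β} (h : s ⊆ t) : Component G s → Component G t :=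
  Quot.map id fun _ _ ⟨e, he, hl⟩ => ⟨e, h he, hl⟩

theorem sign_swap (R : Type*) [CommRing R] {β : Type*} [LinearOrder β] (t : Finset β)
    {e f : β} (he : e ∈ t) (hne : e < f) :
    (-1 : R) ^ (t.filter (· < e)).card * (-1) ^ ((t.erase e).filter (· < f)).card +
      (-1) ^ (t.filter (· < f)).card * (-1) ^ ((t.erase f).filter (· < e)).card = 0 := by
  have h1 : (t.erase f).filter (· < e) = t.filter (· < e) := by
    ext x
    simp only [Finset.mem_filter, Finset.mem_erase]
    exact ⟨fun h => ⟨h.1.2, h.2⟩, fun h => ⟨⟨(h.2.trans hne).ne, h.1⟩, h.2⟩⟩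
  have h2 : (t.filter (· < f)).card = ((t.erase e).filter (· < f)).card + 1 := by
    rw [Finset.filter_erase]
    exact (Finset.card_erase_add_one (by simp [he, hne])).symm
  rw [h1, h2]
  ring

/-- The sets of edges of `G` with exactly `i` elements, i.e. the vertices of height `i` of the cube
`{0,1}^E`. -/
abbrev State (G : Graph α β) (i : ℕ) : Type _ :=
  {s : Finset β // (s : Set β) ⊆ E(G) ∧ s.card = i}

/-- Remove an edge from a state. -/
def State.erase [DecidableEq β] {G : Graph α β} {i : ℕ} (t : State G (i + 1)) (e : t.1) : State G i :=
  ⟨t.1.erase e, fun _ hf => t.2.1 (Finset.erase_subset _ _ hf), by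
    rw [Finset.card_erase_of_mem e.2, t.2.2, Nat.add_sub_cancel]⟩

theorem State.erase_subset [DecidableEq β] {G : Graph α β} {i : ℕ} (t : State G (i + 1))
    (e : t.1) : (t.erase e).1 ⊆ t.1 :=
  Finset.erase_subset e.1 t.1

variable (R : Type*) [CommRing R] (A : Type*) [CommRing A] [Algebra R A]

/-- The tensor product of copies of `A`, one for each component of `[G : s]`. -/
abbrev StateModule (G : Graph α β) (s : Finset β) : Type _ := ⨂[R] _ : Component G s, A

variable [Finite α]

/-- The per-edge map from `s` to `t = s ∪ {e}` (defined for all `s ⊆ t`): if two components of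
`[G : s]` are joined in `[G : t]`, their tensor factors are multiplied, and all the other tensor
factors are mapped identically. -/
def edgeMap (G : Graph α β) {s t : Finset β} (h : s ⊆ t) :
    StateModule R A G s →ₗ[R] StateModule R A G t :=
  merge R A (Component.map G h)

theorem edgeMap_edgeMap (G : Graph α β) {s t u : Finset β} (h : s ⊆ t) (h' : t ⊆ u)
    (x : StateModule R A G s) :
    edgeMap R A G h' (edgeMap R A G h x) = edgeMap R A G (h.trans h') x := by
  unfold edgeMap
  rw [merge_merge]
  congr 1
  congr 1
  funext c
  induction c using Quot.ind
  rfl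

variable [Finite β] [LinearOrder β]

/-- The cochain module `C^i(G)`, the (finite) direct sum of the modules of the states of height `i`.
-/
abbrev Cochain (G : Graph α β) (i : ℕ) : Type _ := (s : State G i) → StateModule R A G s.1

/-- The differential `C^i(G) → C^{i+1}(G)`. Its component at `t` is the sum over the edges `e` of
`t` of the per-edge maps from `t \ {e}` to `t`, with sign `-1` to the number of edges of `t` that
precede `e`. -/
def d (G : Graph α β) (i : ℕ) : Cochain R A G i →ₗ[R] Cochain R A G (i + 1) :=
  LinearMap.pi fun t => ∑ e : t.1, (-1 : R) ^ (t.1.filter (· < e.1)).card •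
    (edgeMap R A G (t.erase_subset e) ∘ₗ LinearMap.proj (t.erase e))

theorem d_apply (G : Graph α β) (i : ℕ) (x : Cochain R A G i) (t : State G (i + 1)) :
    d R A G i x t = ∑ e : t.1, (-1 : R) ^ (t.1.filter (· < e.1)).card •
      edgeMap R A G (t.erase_subset e) (x (t.erase e)) := by
  simp only [d, LinearMap.pi_apply, LinearMap.sum_apply, LinearMap.smul_apply,
    LinearMap.comp_apply, LinearMap.proj_apply]

/-- The cochain groups and differentials form a complex. -/
theorem d_d (G : Graph α β) (i : ℕ) (x : Cochain R A G i) :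
    d R A G (i + 1) (d R A G i x) = 0 := by
  funext t
  rw [d_apply]
  simp only [d_apply, map_sum, map_smul, edgeMap_edgeMap, Finset.smul_sum, smul_smul]
  have key : ∀ (u v : State G i) (hu : u.1 ⊆ t.1) (hv : v.1 ⊆ t.1), u = v →
      edgeMap R A G hu (x u) = edgeMap R A G hv (x v) := by
    rintro u _ hu hv rfl
    rfl
  rw [Finset.sum_sigma', Pi.zero_apply]
  have mem (p : (e : t.1) × (t.erase e).1) : p.2.1 ≠ p.1.1 ∧ p.2.1 ∈ t.1 :=
    Finset.mem_erase.1 p.2.2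
  refine Finset.sum_involution
    (fun p _ => ⟨⟨p.2.1, (mem p).2⟩, ⟨p.1.1, Finset.mem_erase.2 ⟨(mem p).1.symm, p.1.2⟩⟩⟩)
    ?_ ?_ (fun _ _ => Finset.mem_univ _) (fun _ _ => rfl)
  · rintro ⟨e, f⟩ -
    have hf := mem ⟨e, f⟩
    rw [key ((t.erase ⟨f.1, hf.2⟩).erase ⟨e.1, Finset.mem_erase.2 ⟨hf.1.symm, e.2⟩⟩)
      ((t.erase e).erase f) _ (((t.erase e).erase_subset f).trans (t.erase_subset e))
      (Subtype.ext (Finset.erase_right_comm)), ← add_smul]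
    convert zero_smul R _
    rcases lt_or_gt_of_ne hf.1 with h | h
    · rw [add_comm]
      exact sign_swap R t.1 hf.2 h
    · exact sign_swap R t.1 e.2 h
  · rintro ⟨e, f⟩ - - h
    exact (mem ⟨e, f⟩).1 (congrArg (fun p => p.1.1) h)

/-- The cocycles in `C^i(G)`. -/
def cocycles (G : Graph α β) (i : ℕ) : Submodule R (Cochain R A G i) := LinearMap.ker (d R A G i)

/-- The coboundaries in `C^i(G)`. -/
def coboundaries (G : Graph α β) : (i : ℕ) → Submodule R (Cochain R A G i)
  | 0 => ⊥
  | i + 1 => LinearMap.range (d R A G i)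

/-- The cohomology `H^i_A(G)`: cocycles modulo coboundaries. -/
abbrev Cohomology (G : Graph α β) (i : ℕ) : Type _ :=
  cocycles R A G i ⧸ (coboundaries R A G i).submoduleOf (cocycles R A G i)

/-! ### The grading -/

variable {R A}
variable (𝒜 : ℕ → Submodule R A)

/-- The homogeneous elements of degree `j` in the tensor product over the components of `[G : s]`.
-/
def stateDegree (G : Graph α β) (s : Finset β) (j : ℕ) : Submodule R (StateModule R A G s) :=
  Submodule.span R {x | ∃ (δ : Component G s → ℕ) (a : Component G s → A),
    (∀ c, a c ∈ 𝒜 (δ c)) ∧ ∑ c, δ c = j ∧ x = PiTensorProduct.tprod R a}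

/-- The homogeneous part `C^{i,j}(G)` of degree `j` of `C^i(G)`. -/
def cochainDegree (G : Graph α β) (i j : ℕ) : Submodule R (Cochain R A G i) :=
  Submodule.pi Set.univ fun s => stateDegree 𝒜 G s.1 j

/-- The homogeneous part `H^{i,j}_A(G)` of degree `j` of `H^i_A(G)`: the cohomology classes of the
cocycles in `C^{i,j}(G)`. -/
def cohomologyDegree (G : Graph α β) (i j : ℕ) : Submodule R (Cohomology R A G i) :=
  ((cochainDegree 𝒜 G i j).submoduleOf (cocycles R A G i)).map (Submodule.mkQ _)

/-- `H^i_A(G)` and `H^{i'}_A(G')` are isomorphic as graded modules. -/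
def GradedIso {α' β' : Type*} [Finite α'] [Finite β'] [LinearOrder β']
    (G : Graph α β) (i : ℕ) (G' : Graph α' β') (i' : ℕ) : Prop :=
  ∃ φ : Cohomology R A G i ≃ₗ[R] Cohomology R A G' i',
    ∀ j, (cohomologyDegree 𝒜 G i j).map (φ : _ →ₗ[R] _) = cohomologyDegree 𝒜 G' i' j

end Complex

/-! ### Polygons -/

/-- The polygon `P_n` with `n` vertices and `n` edges, edge number `e` joining vertex number `e` to
the next one in cyclic order. `P_1` is a vertex with a loop, `P_2` is two vertices joined by two
edges. -/
def polygon (n : ℕ) : Graph (Fin n) (Fin n) where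
  vertexSet := Set.univ
  edgeSet := Set.univ
  IsLink e x y := s(x, y) = s(e, finRotate n e)
  isLink_symm _ _ := ⟨fun _ _ h => Sym2.eq_swap.trans h⟩
  eq_or_eq_of_isLink_of_isLink _ _ _ _ _ h h' := by
    have := h.trans h'.symm
    rw [Sym2.eq_iff] at this
    tauto
  edge_mem_iff_exists_isLink e := ⟨fun _ => ⟨e, finRotate n e, rfl⟩, fun _ => trivial⟩
  left_mem_of_isLink _ _ _ _ := trivial

end

end GraphCohomology

namespace GraphCohomology

noncomputable section

/-! ### Merging: identities and degrees -/

section Merge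

variable (R : Type*) [CommRing R] {A : Type*} [CommRing A] [Algebra R A]
variable {ι κ : Type*} [Fintype ι] [DecidableEq κ]

/-! The argument is deletion–contraction at the last edge `ℓ` of `P_{n+2}`. The cochains supported
on edge sets containing `ℓ` form a subcomplex. Contracting `ℓ` identifies it with the complex of
`P_{n+1}` shifted by one height; no sign appears because `ℓ` is the largest edge
(`d_expandCochain`). The quotient is the complex of the path obtained by deleting `ℓ`.

The path is acyclic in positive heights (`exists_primitive`). It grows by pendant edges: when the
edge `k` is added, its right end is isolated in every state whose edges precede `k`. The
multiplication map along `k` then has a section, which puts `1` on that end, and these sections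
assemble into a homotopy (`split`).

Consequently `H^i(P_{n+1}) → H^{i+1}(P_{n+2})` is bijective for `i ≥ 1`. Instead of a long exact
sequence, the proof uses one decomposition, `exists_eq_d_add_expandCochain`, for both injectivity
and surjectivity. All the maps preserve degree, so the isomorphism is graded. Iterating it gives the
second claim; the vanishing holds because `P_n` has no set of more than `n` edges. -/

theorem merge_id [DecidableEq ι] (x : ⨂[R] _ : ι, A) : merge R A id x = x := by
  suffices h : merge R A (id : ι → ι) = LinearMap.id from LinearMap.congr_fun h x
  ext a
  simp only [LinearMap.compMultilinearMap_apply, merge_tprod, LinearMap.id_apply, id]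
  congr 1
  funext k
  rw [Finset.prod_filter, Finset.prod_ite_eq' Finset.univ k a, if_pos (Finset.mem_univ k)]

variable {R}

/-- Merging preserves homogeneous tensors of a given total degree. -/
theorem merge_mem_span [Fintype κ] (𝒜 : ℕ → Submodule R A) [GradedAlgebra 𝒜] (f : ι → κ) (j : ℕ)
    {x : ⨂[R] _ : ι, A}
    (hx : x ∈ Submodule.span R {x | ∃ (δ : ι → ℕ) (a : ι → A),
      (∀ c, a c ∈ 𝒜 (δ c)) ∧ ∑ c, δ c = j ∧ x = PiTensorProduct.tprod R a}) :
    merge R A f x ∈ Submodule.span R {x | ∃ (δ : κ → ℕ) (a : κ → A),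
      (∀ c, a c ∈ 𝒜 (δ c)) ∧ ∑ c, δ c = j ∧ x = PiTensorProduct.tprod R a} := by
  induction hx using Submodule.span_induction with
  | mem x hx =>
    obtain ⟨δ, a, ha, hδ, rfl⟩ := hx
    refine Submodule.subset_span ⟨fun k => ∑ c with f c = k, δ c,
      fun k => ∏ c with f c = k, a c, fun k => ?_, ?_, merge_tprod R A f a⟩
    · exact SetLike.prod_mem_graded _ _ _ fun c _ => ha c
    · rw [← hδ, Finset.sum_fiberwise]
  | zero => simp
  | add x y _ _ hx hy => rw [map_add]; exact add_mem hx hy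
  | smul r x _ hx => rw [map_smul]; exact Submodule.smul_mem _ r hx

end Merge

/-! ### Graded isomorphisms -/

section GradedIso

set_option linter.unusedSectionVars false

variable {R : Type*} [CommRing R] {A : Type*} [CommRing A] [Algebra R A] (𝒜 : ℕ → Submodule R A)
variable {α β α' β' α'' β'' : Type*} [Finite α] [Finite β] [LinearOrder β]
  [Finite α'] [Finite β'] [LinearOrder β'] [Finite α''] [Finite β''] [LinearOrder β'']

theorem GradedIso.refl (G : Graph α β) (i : ℕ) : GradedIso 𝒜 G i G i :=
  ⟨LinearEquiv.refl R _, fun _ => Submodule.map_id _⟩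

variable {𝒜} in
theorem GradedIso.symm {G : Graph α β} {i : ℕ} {G' : Graph α' β'} {i' : ℕ}
    (h : GradedIso 𝒜 G i G' i') : GradedIso 𝒜 G' i' G i := by
  obtain ⟨φ, hφ⟩ := h
  refine ⟨φ.symm, fun j => ?_⟩
  rw [← hφ j, ← Submodule.map_comp]
  simp

variable {𝒜} in
theorem GradedIso.trans {G : Graph α β} {i : ℕ} {G' : Graph α' β'} {i' : ℕ} {G'' : Graph α'' β''}
    {i'' : ℕ} (h : GradedIso 𝒜 G i G' i') (h' : GradedIso 𝒜 G' i' G'' i'') :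
    GradedIso 𝒜 G i G'' i'' := by
  obtain ⟨φ, hφ⟩ := h
  obtain ⟨ψ, hψ⟩ := h'
  refine ⟨φ.trans ψ, fun j => ?_⟩
  rw [← hψ j, ← hφ j, ← Submodule.map_comp]
  rfl

/-- In heights exceeding the number of edges there is no cohomology. -/
theorem subsingleton_cohomology_of_card_lt (G : Graph α β) (i : ℕ) (hi : Nat.card β < i) :
    Subsingleton (Cohomology R A G i) := by
  have : Fintype β := Fintype.ofFinite β
  have : IsEmpty (State G i) := ⟨fun s => by
    have := s.1.card_le_univ
    rw [s.2.2, ← Nat.card_eq_fintype_card] at this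
    omega⟩
  infer_instance

end GradedIso

/-! ### Maps between the state modules of polygons induced by maps of vertices -/

section Push

variable {n n' n'' : ℕ}

/-- The component of the vertex `v` in the spanning subgraph of the polygon with edge set `s`. -/
def cls (s : Finset (Fin n)) (v : Fin n) : Component (polygon n) s :=
  Quot.mk _ ⟨v, trivial⟩

theorem cls_finRotate {s : Finset (Fin n)} {e : Fin n} (he : e ∈ s) :
    cls s e = cls s (finRotate n e) :=
  Quot.sound ⟨e, he, rfl⟩

/-- `p` sends the ends of every edge of `s` to the same component of `s'`. -/
def Compatible (p : Fin n → Fin n') (s : Finset (Fin n)) (s' : Finset (Fin n')) : Prop :=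
  ∀ e ∈ s, cls s' (p e) = cls s' (p (finRotate n e))

theorem Compatible.of_subset {s t : Finset (Fin n)} (h : s ⊆ t) : Compatible id s t :=
  fun _ he => cls_finRotate (h he)

/-- The map of components induced by a compatible map of vertices. -/
def Compatible.map {p : Fin n → Fin n'} {s : Finset (Fin n)} {s' : Finset (Fin n')}
    (h : Compatible p s s') : Component (polygon n) s → Component (polygon n') s' :=
  Quot.lift (fun v => cls s' (p v.1)) fun x y ⟨e, he, hl⟩ => by
    change s(x.1, y.1) = s(e, finRotate n e) at hl
    rcases Sym2.eq_iff.1 hl with ⟨hx, hy⟩ | ⟨hx, hy⟩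
    · rw [hx, hy]; exact h e he
    · rw [hx, hy]; exact (h e he).symm

variable (R : Type*) [CommRing R] (A : Type*) [CommRing A] [Algebra R A]

/-- The map of state modules induced by a compatible map of vertices. -/
def push {p : Fin n → Fin n'} {s : Finset (Fin n)} {s' : Finset (Fin n')}
    (h : Compatible p s s') :
    StateModule R A (polygon n) s →ₗ[R] StateModule R A (polygon n') s' :=
  merge R A h.map

theorem edgeMap_eq_push {s t : Finset (Fin n)} (h : s ⊆ t) :
    edgeMap R A (polygon n) h = push R A (Compatible.of_subset h) := by
  unfold edgeMap push
  congr 1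

theorem d_polygon_apply {i : ℕ} (x : Cochain R A (polygon n) i) (t : State (polygon n) (i + 1)) :
    d R A (polygon n) i x t = ∑ e : t.1, (-1 : R) ^ (t.1.filter (· < e.1)).card •
      push R A (.of_subset (t.erase_subset e)) (x (t.erase e)) := by
  rw [d_apply]
  refine Finset.sum_congr rfl fun e _ => ?_
  rw [edgeMap_eq_push]

/-- Only the component of the image matters, so `q` need agree with the composite merely up to
components of `s''`. This lets maps that are not inverse on vertices induce inverse maps of state
modules. -/
theorem push_push {p : Fin n → Fin n'} {p' : Fin n' → Fin n''} {q : Fin n → Fin n''}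
    {s : Finset (Fin n)} {s' : Finset (Fin n')} {s'' : Finset (Fin n'')}
    (h : Compatible p s s') (h' : Compatible p' s' s'') (hq : Compatible q s s'')
    (hpq : ∀ v, cls s'' (p' (p v)) = cls s'' (q v)) (x : StateModule R A (polygon n) s) :
    push R A h' (push R A h x) = push R A hq x := by
  unfold push
  rw [merge_merge]
  congr 2
  funext c
  induction c using Quot.ind
  exact hpq _

theorem push_eq_self {p : Fin n → Fin n} {s : Finset (Fin n)} (h : Compatible p s s)
    (hp : ∀ v, cls s (p v) = cls s v) (x : StateModule R A (polygon n) s) :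
    push R A h x = x := by
  refine Eq.trans ?_ (merge_id R x)
  unfold push
  congr 2
  funext c
  induction c using Quot.ind
  exact hp _

variable {R A} in
-- Replaces a state by a propositionally equal one without casting between the two tensor products;
-- `push_cochain_eq` serves the same purpose.
theorem push_cochain_congr {i : ℕ} (x : Cochain R A (polygon n) i) {p : Fin n → Fin n'}
    {u v : State (polygon n) i} (huv : u = v) {s' : Finset (Fin n')} (h : Compatible p u.1 s')
    (h' : Compatible p v.1 s') : push R A h (x u) = push R A h' (x v) := by
  subst huv; rfl

variable {R A} in
theorem push_cochain_eq {i : ℕ} (x : Cochain R A (polygon n) i) {p : Fin n → Fin n}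
    {u v : State (polygon n) i} (huv : u = v) (h : Compatible p u.1 v.1)
    (hp : ∀ w, cls v.1 (p w) = cls v.1 w) : push R A h (x u) = x v := by
  subst huv; exact push_eq_self R A h hp _

variable {R A} in
theorem push_mem_stateDegree (𝒜 : ℕ → Submodule R A) [GradedAlgebra 𝒜] {p : Fin n → Fin n'}
    {s : Finset (Fin n)} {s' : Finset (Fin n')} (h : Compatible p s s') {j : ℕ}
    {x : StateModule R A (polygon n) s} (hx : x ∈ stateDegree 𝒜 (polygon n) s j) :
    push R A h x ∈ stateDegree 𝒜 (polygon n') s' j :=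
  merge_mem_span 𝒜 h.map j hx

variable {R A} in
theorem d_mem_cochainDegree (𝒜 : ℕ → Submodule R A) [GradedAlgebra 𝒜] {i j : ℕ}
    {x : Cochain R A (polygon n) i} (hx : x ∈ cochainDegree 𝒜 (polygon n) i j) :
    d R A (polygon n) i x ∈ cochainDegree 𝒜 (polygon n) (i + 1) j := by
  intro t _
  rw [d_polygon_apply]
  refine sum_mem fun e _ => Submodule.smul_mem _ _ ?_
  exact push_mem_stateDegree 𝒜 _ (hx _ trivial)

end Push

/-! ### The path obtained by deleting the last edge is acyclic in positive heights -/

section Path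

variable {n : ℕ}

theorem finRotate_castSucc (k : Fin n) : finRotate (n + 1) k.castSucc = k.succ := by
  rw [finRotate_apply, Fin.coeSucc_eq_succ]

/-- Move the right end of the edge `k` onto its left end. -/
def fold (k : Fin n) (v : Fin (n + 1)) : Fin (n + 1) :=
  if v = k.succ then k.castSucc else v

theorem cls_fold {t : Finset (Fin (n + 1))} {k : Fin n} (h : k.castSucc ∈ t) (v : Fin (n + 1)) :
    cls t (fold k v) = cls t v := by
  unfold fold
  split_ifs with hv
  · rw [hv, cls_finRotate h, finRotate_castSucc]
  · rfl

/-- An edge preceding `k` does not touch the right end of `k`, so folding fixes both its ends; the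
edge `k` itself collapses to a point. Hence `k` may lie in `s` without lying in `t`. The isolated
right end is then missed, and merging fills its tensor factor with the empty product `1`. -/
theorem compatible_fold {s t : Finset (Fin (n + 1))} {k : Fin n}
    (hs : ∀ f ∈ s, f ≠ k.castSucc → f < k.castSucc ∧ f ∈ t) : Compatible (fold k) s t := by
  intro e he
  by_cases hek : e = k.castSucc
  · subst hek
    rw [finRotate_castSucc]
    simp [fold, Fin.castSucc_lt_succ.ne]
  · obtain ⟨h1, h2⟩ := hs e he hek
    obtain ⟨e', rfl⟩ := Fin.exists_castSucc_eq.2 (h1.trans_le (Fin.le_last _)).ne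
    have h3 : e'.castSucc ≠ k.succ := (h1.trans Fin.castSucc_lt_succ).ne
    have h4 : e'.succ ≠ k.succ := fun h => hek (by rw [Fin.succ_injective _ h])
    rw [finRotate_castSucc, fold, fold, if_neg h3, if_neg h4, cls_finRotate h2, finRotate_castSucc]

/-- Add to a state an edge that exceeds all its edges. -/
def State.insertTop {i : ℕ} (s : State (polygon n) i) (e : Fin n) (h : ∀ f ∈ s.1, f < e) :
    State (polygon n) (i + 1) :=
  ⟨insert e s.1, fun _ _ => trivial, by
    rw [Finset.card_insert_of_notMem fun he => (h e he).false, s.2.2]⟩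

variable {R : Type*} [CommRing R] {A : Type*} [CommRing A] [Algebra R A]

/-- Drop the edge `k` from the states with largest edge `k`, splitting the component that contains
`k` by putting `1` on the right end of `k`. -/
def split {i : ℕ} (k : Fin n) (z : Cochain R A (polygon (n + 1)) (i + 1)) :
    Cochain R A (polygon (n + 1)) i := fun s =>
  open Classical in
  if h : ∀ f ∈ s.1, f < k.castSucc then
    (-1 : R) ^ i • push R A (compatible_fold (s := (s.insertTop _ h).1) (t := s.1) fun f hf hfk =>
      have := (Finset.mem_insert.1 hf).resolve_left hfk
      ⟨h f this, this⟩) (z (s.insertTop _ h))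
  else 0

theorem split_mem_cochainDegree (𝒜 : ℕ → Submodule R A) [GradedAlgebra 𝒜] {i j : ℕ} (k : Fin n)
    {z : Cochain R A (polygon (n + 1)) (i + 1)}
    (hz : z ∈ cochainDegree 𝒜 (polygon (n + 1)) (i + 1) j) :
    split k z ∈ cochainDegree 𝒜 (polygon (n + 1)) i j := by
  intro s _
  unfold split
  split_ifs with h
  · exact Submodule.smul_mem _ _ (push_mem_stateDegree 𝒜 _ (hz _ trivial))
  · exact zero_mem _

/-- Restoring `k` multiplies by the `1` that `split` inserted, and this recovers `z t`. -/
theorem d_split_of_mem {i : ℕ} (k : Fin n) (z : Cochain R A (polygon (n + 1)) (i + 1))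
    (t : State (polygon (n + 1)) (i + 1)) (ht : ∀ f ∈ t.1, f ≤ k.castSucc)
    (hk : k.castSucc ∈ t.1) : d R A (polygon (n + 1)) i (split k z) t = z t := by
  have hlt : ∀ f ∈ (t.erase ⟨_, hk⟩).1, f < k.castSucc := fun f hf =>
    have hf' := Finset.mem_erase.1 hf
    (ht f hf'.2).lt_of_ne hf'.1
  rw [d_polygon_apply, Finset.sum_eq_single ⟨_, hk⟩]
  -- The other `i` edges of `t` all precede `k`, so the sign of the differential cancels the sign in
  -- `split`.
  · have hcard : (t.1.filter (· < k.castSucc)).card = i := by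
      have h1 : t.1.filter (· < k.castSucc) = (t.erase ⟨_, hk⟩).1 := by
        ext f
        simp only [Finset.mem_filter, State.erase, Finset.mem_erase]
        exact ⟨fun h => ⟨h.2.ne, h.1⟩, fun h => ⟨h.2, (ht f h.2).lt_of_ne h.1⟩⟩
      rw [h1, (t.erase _).2.2]
    have hins : (t.erase ⟨_, hk⟩).insertTop _ hlt = t :=
      Subtype.ext (Finset.insert_erase hk)
    have hc : Compatible (fold k) ((t.erase ⟨_, hk⟩).insertTop _ hlt).1 t.1 := by
      rw [hins]
      exact compatible_fold fun f hf hfk => ⟨(ht f hf).lt_of_ne hfk, hf⟩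
    rw [split, dif_pos hlt, map_smul, smul_smul, hcard, ← mul_pow, neg_one_mul, neg_neg, one_pow,
      one_smul]
    refine Eq.trans (push_push R A _ _ hc ?_ _) (push_cochain_eq z hins hc fun v => cls_fold hk v)
    exact fun _ => rfl
  -- Removing an edge other than `k` leaves a state that still contains `k`, where `split` is zero
  -- by definition.
  · intro f _ hf
    rw [split, dif_neg, map_zero, smul_zero]
    exact fun h => (h _ (Finset.mem_erase.2 ⟨fun h' => hf (Subtype.ext h'.symm), hk⟩)).false
  · simp

/-- Folding commutes with the per-edge maps of the edges of `t`, so the sum is, up to sign, the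
folded image of `d z` at `t ∪ {k}`, apart from the term that removes `k`. -/
theorem d_split_of_lt {i : ℕ} (k : Fin n) (z : Cochain R A (polygon (n + 1)) (i + 1))
    (hz : ∀ s : State (polygon (n + 1)) (i + 1), (∀ f ∈ s.1, f < k.castSucc) → z s = 0)
    (t : State (polygon (n + 1)) (i + 1)) (ht : ∀ f ∈ t.1, f < k.castSucc)
    (hdz : d R A (polygon (n + 1)) (i + 1) z (t.insertTop _ ht) = 0) :
    d R A (polygon (n + 1)) i (split k z) t = 0 := by
  have hc : Compatible (fold k) (t.insertTop _ ht).1 t.1 := compatible_fold fun f hf hfk =>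
    have := (Finset.mem_insert.1 hf).resolve_left hfk
    ⟨ht f this, this⟩
  have key := congrArg (fun x => (-1 : R) ^ i • push R A hc x) hdz
  simp only [map_zero, smul_zero] at key
  rw [← key, d_polygon_apply, d_polygon_apply, map_sum, Finset.smul_sum]
  refine Finset.sum_of_injOn (fun f => ⟨f.1, Finset.mem_insert_of_mem f.2⟩) ?_ ?_ ?_ ?_
  · exact fun f _ g _ h => Subtype.ext (congrArg (fun x => x.1) h)
  · exact fun _ _ => Finset.mem_coe.2 (Finset.mem_univ _)
  · rintro ⟨f, hf⟩ - hf'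
    rcases Finset.mem_insert.1 hf with rfl | hft
    -- Removing `k` gives back `t`, where `z` vanishes by `hz`.
    · rw [hz, map_zero, smul_zero, map_zero, smul_zero]
      intro f hf
      have hf := Finset.mem_erase.1 hf
      exact ht f ((Finset.mem_insert.1 hf.2).resolve_left hf.1)
    · exact (hf' ⟨⟨f, hft⟩, by simp, rfl⟩).elim
  · rintro ⟨f, hf⟩ -
    have hlt : ∀ g ∈ (t.erase ⟨f, hf⟩).1, g < k.castSucc := fun g hg =>
      ht g (Finset.mem_of_mem_erase hg)
    have hfilter : (t.insertTop _ ht).1.filter (· < f) = t.1.filter (· < f) := by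
      ext g
      simp only [State.insertTop, Finset.mem_filter, Finset.mem_insert]
      exact ⟨fun h => ⟨h.1.resolve_left (h.2.trans (ht f hf)).ne, h.2⟩, fun h => ⟨.inr h.1, h.2⟩⟩
    have hins : (t.erase ⟨f, hf⟩).insertTop _ hlt =
        (t.insertTop _ ht).erase ⟨f, Finset.mem_insert_of_mem hf⟩ := by
      refine Subtype.ext ?_
      ext g
      simp only [State.insertTop, State.erase, Finset.mem_insert, Finset.mem_erase]
      have : k.castSucc ≠ f := (ht f hf).ne'
      grind
    have hc1 : Compatible (fold k) ((t.erase ⟨f, hf⟩).insertTop _ hlt).1 t.1 := by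
      rw [hins]
      exact fun g hg => hc g (Finset.mem_of_mem_erase hg)
    have hc2 : Compatible (fold k)
        ((t.insertTop _ ht).erase ⟨f, Finset.mem_insert_of_mem hf⟩).1 t.1 :=
      fun g hg => hc g (Finset.mem_of_mem_erase hg)
    rw [split, dif_pos hlt, map_smul, map_smul, smul_smul, smul_smul, mul_comm, hfilter]
    congr 1
    refine Eq.trans (push_push R A _ _ hc1 ?_ _) (Eq.trans (push_cochain_congr z hins hc1 hc2)
      (Eq.symm (push_push R A _ hc hc2 ?_ _)))
    exacts [fun _ => rfl, fun _ => rfl]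

/-- A cochain of positive height that is closed on the states whose edges precede `k` is exact on
them, by a primitive of the same degree. -/
theorem exists_primitive (𝒜 : ℕ → Submodule R A) [GradedAlgebra 𝒜] {i : ℕ} (k : ℕ) (hk : k ≤ n)
    (z : Cochain R A (polygon (n + 1)) (i + 1))
    (hz : ∀ t, (∀ f ∈ t.1, f.val < k) → d R A (polygon (n + 1)) (i + 1) z t = 0) :
    ∃ y : Cochain R A (polygon (n + 1)) i,
      (∀ j, z ∈ cochainDegree 𝒜 (polygon (n + 1)) (i + 1) j →
        y ∈ cochainDegree 𝒜 (polygon (n + 1)) i j) ∧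
      ∀ s, (∀ f ∈ s.1, f.val < k) → d R A (polygon (n + 1)) i y s = z s := by
  induction k with
  | zero =>
    refine ⟨0, fun _ _ => zero_mem _, fun s hs => ?_⟩
    -- With no edges allowed only the empty state remains, and positive height excludes it.
    obtain ⟨f, hf⟩ := Finset.card_pos.1 (s.2.2.symm ▸ Nat.succ_pos i : 0 < s.1.card)
    exact absurd (hs f hf) (Nat.not_lt_zero _)
  | succ k ih =>
    obtain ⟨y, hy, hdy⟩ := ih (by omega) fun t ht => hz t fun f hf => (ht f hf).trans k.lt_succ_self
    let e : Fin n := ⟨k, hk⟩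
    -- After subtracting `d y`, among states with edges at most `k` only those containing `k` can
    -- carry a nonzero value; `split` provides a primitive there without changing `d` on the earlier
    -- states.
    have hz' : ∀ s : State (polygon (n + 1)) (i + 1), (∀ f ∈ s.1, f < e.castSucc) →
        (z - d R A (polygon (n + 1)) i y) s = 0 := fun s hs => by
      rw [Pi.sub_apply, hdy s hs, sub_self]
    have hdz' : ∀ t, (∀ f ∈ t.1, f.val < k + 1) →
        d R A (polygon (n + 1)) (i + 1) (z - d R A (polygon (n + 1)) i y) t = 0 := fun t ht => by
      rw [map_sub, d_d, sub_zero, hz t ht]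
    refine ⟨y + split e (z - d R A (polygon (n + 1)) i y), fun j hj => ?_, fun s hs => ?_⟩
    · exact add_mem (hy j hj) (split_mem_cochainDegree 𝒜 e
        (sub_mem hj (d_mem_cochainDegree 𝒜 (hy j hj))))
    · rw [map_add, Pi.add_apply]
      by_cases hes : e.castSucc ∈ s.1
      · rw [d_split_of_mem e _ s (fun f hf => Nat.lt_succ_iff.1 (hs f hf)) hes, Pi.sub_apply,
          add_sub_cancel]
      · have hs' : ∀ f ∈ s.1, f < e.castSucc := fun f hf =>
          lt_of_le_of_ne (Nat.lt_succ_iff.1 (hs f hf)) fun h => hes (h ▸ hf)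
        rw [d_split_of_lt e _ hz' s hs', add_zero, hdy s hs']
        refine hdz' _ fun f hf => ?_
        rcases Finset.mem_insert.1 hf with rfl | hf
        · exact k.lt_succ_self
        · exact hs f hf

end Path

/-! ### Contraction of the last edge -/

section Contract

variable {n : ℕ}

/-- The vertex map `P_{n+2} → P_{n+1}` that contracts the last edge, which joins the last vertex to
the vertex `0`. -/
def contract (v : Fin (n + 2)) : Fin (n + 1) := Fin.lastCases 0 id v

@[simp] theorem contract_last : contract (Fin.last (n + 1)) = 0 := Fin.lastCases_last

@[simp] theorem contract_castSucc (v : Fin (n + 1)) : contract v.castSucc = v :=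
  Fin.lastCases_castSucc _

theorem contract_finRotate_castSucc (f : Fin (n + 1)) :
    contract (finRotate (n + 2) f.castSucc) = finRotate (n + 1) f := by
  rw [finRotate_castSucc]
  induction f using Fin.lastCases with
  | last => rw [Fin.succ_last, contract_last, finRotate_last]
  | cast f => rw [← Fin.castSucc_succ, contract_castSucc, finRotate_castSucc]

/-- The last edge already joins the one vertex that moves to its image `0`; this makes `contract`
and `Fin.castSucc` inverse on components. -/
theorem cls_castSucc_contract {t : Finset (Fin (n + 2))} (ht : Fin.last (n + 1) ∈ t)
    (v : Fin (n + 2)) : cls t (contract v).castSucc = cls t v := by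
  induction v using Fin.lastCases with
  | last => rw [contract_last, cls_finRotate ht, finRotate_last, Fin.castSucc_zero]
  | cast v => rw [contract_castSucc]

/-- The state of `P_{n+1}` obtained by contracting the last edge of `P_{n+2}`. -/
def State.contract {i : ℕ} (t : State (polygon (n + 2)) (i + 1)) (ht : Fin.last (n + 1) ∈ t.1) :
    State (polygon (n + 1)) i :=
  ⟨Finset.univ.filter fun f => f.castSucc ∈ t.1, fun _ _ => trivial, by
    have h : (Finset.univ.filter fun f : Fin (n + 1) => f.castSucc ∈ t.1).map Fin.castSuccEmb =
        t.1.erase (Fin.last (n + 1)) := by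
      ext f
      induction f using Fin.lastCases with
      | last => simp [Fin.castSucc_ne_last]
      | cast f => simp [Fin.castSucc_ne_last]
    rw [← Finset.card_map Fin.castSuccEmb, h, Finset.card_erase_of_mem ht, t.2.2,
      Nat.add_sub_cancel]⟩

theorem State.mem_contract {i : ℕ} {t : State (polygon (n + 2)) (i + 1)}
    {ht : Fin.last (n + 1) ∈ t.1} {f : Fin (n + 1)} :
    f ∈ (t.contract ht).1 ↔ f.castSucc ∈ t.1 := by
  simp [State.contract]

/-- The state of `P_{n+2}` that contains the last edge and contracts to a given one. -/
def State.expand {i : ℕ} (s : State (polygon (n + 1)) i) : State (polygon (n + 2)) (i + 1) :=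
  ⟨insert (Fin.last (n + 1)) (s.1.map Fin.castSuccEmb), fun _ _ => trivial, by
    rw [Finset.card_insert_of_notMem (by simp [Fin.castSucc_ne_last]), Finset.card_map, s.2.2]⟩

theorem State.last_mem_expand {i : ℕ} (s : State (polygon (n + 1)) i) :
    Fin.last (n + 1) ∈ s.expand.1 :=
  Finset.mem_insert_self _ _

theorem State.castSucc_mem_expand {i : ℕ} {s : State (polygon (n + 1)) i} {f : Fin (n + 1)} :
    f.castSucc ∈ s.expand.1 ↔ f ∈ s.1 := by
  simp [State.expand, Fin.castSucc_ne_last]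

theorem State.contract_expand {i : ℕ} (s : State (polygon (n + 1)) i) :
    s.expand.contract s.last_mem_expand = s :=
  Subtype.ext (Finset.ext fun _ => State.mem_contract.trans State.castSucc_mem_expand)

theorem State.expand_contract {i : ℕ} (t : State (polygon (n + 2)) (i + 1))
    (ht : Fin.last (n + 1) ∈ t.1) : (t.contract ht).expand = t := by
  refine Subtype.ext (Finset.ext fun f => ?_)
  induction f using Fin.lastCases with
  | last => exact iff_of_true (State.last_mem_expand _) ht
  | cast f => exact State.castSucc_mem_expand.trans State.mem_contract

theorem compatible_castSucc {s : Finset (Fin (n + 1))} {t : Finset (Fin (n + 2))}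
    (ht : Fin.last (n + 1) ∈ t) (hs : ∀ f ∈ s, f.castSucc ∈ t) :
    Compatible Fin.castSucc s t := by
  intro f hf
  rw [← contract_finRotate_castSucc, cls_castSucc_contract ht, cls_finRotate (hs f hf)]

theorem compatible_contract {s : Finset (Fin (n + 1))} {t : Finset (Fin (n + 2))}
    (hs : ∀ f : Fin (n + 1), f.castSucc ∈ t → f ∈ s) : Compatible contract t s := by
  intro f hf
  induction f using Fin.lastCases with
  | last =>
    rw [finRotate_last, contract_last]
    exact congrArg _ (contract_castSucc 0).symm
  | cast f => rw [contract_finRotate_castSucc, contract_castSucc, cls_finRotate (hs f hf)]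

variable {R : Type*} [CommRing R] {A : Type*} [CommRing A] [Algebra R A]

variable (R A) in
/-- The inclusion of the cochains of `P_{n+1}` as the cochains of `P_{n+2}` supported on the states
that contain the last edge. -/
def expandCochain (n i : ℕ) :
    Cochain R A (polygon (n + 1)) i →ₗ[R] Cochain R A (polygon (n + 2)) (i + 1) :=
  LinearMap.pi fun t => open Classical in
    if ht : Fin.last (n + 1) ∈ t.1 then
      push R A (compatible_castSucc (s := (t.contract ht).1) ht fun _ => State.mem_contract.1) ∘ₗ
        LinearMap.proj (t.contract ht)
    else 0

theorem expandCochain_of_mem {i : ℕ} (x : Cochain R A (polygon (n + 1)) i)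
    {t : State (polygon (n + 2)) (i + 1)} (ht : Fin.last (n + 1) ∈ t.1) :
    expandCochain R A n i x t = push R A (compatible_castSucc (s := (t.contract ht).1) ht
      fun _ => State.mem_contract.1) (x (t.contract ht)) := by
  rw [expandCochain, LinearMap.pi_apply, dif_pos ht]
  rfl

theorem expandCochain_of_notMem {i : ℕ} (x : Cochain R A (polygon (n + 1)) i)
    {t : State (polygon (n + 2)) (i + 1)} (ht : Fin.last (n + 1) ∉ t.1) :
    expandCochain R A n i x t = 0 := by
  rw [expandCochain, LinearMap.pi_apply, dif_neg ht]
  rfl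

variable (R A) in
/-- Contraction of the last edge on the cochains of `P_{n+2}`. -/
def contractCochain (n i : ℕ) :
    Cochain R A (polygon (n + 2)) (i + 1) →ₗ[R] Cochain R A (polygon (n + 1)) i :=
  LinearMap.pi fun s =>
    push R A (compatible_contract fun _ => State.castSucc_mem_expand.1) ∘ₗ LinearMap.proj s.expand

theorem contractCochain_expandCochain {i : ℕ} (x : Cochain R A (polygon (n + 1)) i) :
    contractCochain R A n i (expandCochain R A n i x) = x := by
  funext s
  have hc : Compatible id (s.expand.contract s.last_mem_expand).1 s.1 := by
    rw [s.contract_expand]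
    exact .of_subset subset_rfl
  refine Eq.trans ?_ (push_cochain_eq x s.contract_expand hc fun _ => rfl)
  rw [contractCochain, LinearMap.pi_apply, LinearMap.comp_apply, LinearMap.proj_apply,
    expandCochain_of_mem x s.last_mem_expand]
  exact push_push R A _ _ hc (fun v => by rw [contract_castSucc, id]) _

theorem expandCochain_contractCochain {i : ℕ} (x : Cochain R A (polygon (n + 2)) (i + 1))
    (hx : ∀ t, Fin.last (n + 1) ∉ t.1 → x t = 0) :
    expandCochain R A n i (contractCochain R A n i x) = x := by
  funext t
  by_cases ht : Fin.last (n + 1) ∈ t.1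
  · have hc : Compatible id (t.contract ht).expand.1 t.1 := by
      rw [t.expand_contract]
      exact .of_subset subset_rfl
    refine Eq.trans ?_ (push_cochain_eq x (t.expand_contract ht) hc fun _ => rfl)
    rw [expandCochain_of_mem _ ht]
    exact push_push R A _ _ hc (cls_castSucc_contract ht) _
  · rw [expandCochain_of_notMem _ ht, hx t ht]

theorem expandCochain_injective (i : ℕ) : Function.Injective (expandCochain R A n i) :=
  Function.LeftInverse.injective contractCochain_expandCochain

theorem expandCochain_mem (𝒜 : ℕ → Submodule R A) [GradedAlgebra 𝒜] {i j : ℕ}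
    {x : Cochain R A (polygon (n + 1)) i} (hx : x ∈ cochainDegree 𝒜 (polygon (n + 1)) i j) :
    expandCochain R A n i x ∈ cochainDegree 𝒜 (polygon (n + 2)) (i + 1) j := by
  intro t _
  by_cases ht : Fin.last (n + 1) ∈ t.1
  · rw [expandCochain_of_mem x ht]
    exact push_mem_stateDegree 𝒜 _ (hx _ trivial)
  · rw [expandCochain_of_notMem x ht]
    exact zero_mem _

theorem contractCochain_mem (𝒜 : ℕ → Submodule R A) [GradedAlgebra 𝒜] {i j : ℕ}
    {x : Cochain R A (polygon (n + 2)) (i + 1)}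
    (hx : x ∈ cochainDegree 𝒜 (polygon (n + 2)) (i + 1) j) :
    contractCochain R A n i x ∈ cochainDegree 𝒜 (polygon (n + 1)) i j :=
  fun _ _ => push_mem_stateDegree 𝒜 _ (hx _ trivial)

/-- The term removing the last edge vanishes, and the remaining terms match those of `P_{n+1}` with
equal signs, since the last edge precedes no other. -/
theorem d_expandCochain {i : ℕ} (x : Cochain R A (polygon (n + 1)) i) :
    d R A (polygon (n + 2)) (i + 1) (expandCochain R A n i x) =
      expandCochain R A n (i + 1) (d R A (polygon (n + 1)) i x) := by
  funext t
  rw [d_polygon_apply]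
  by_cases ht : Fin.last (n + 1) ∈ t.1
  · rw [expandCochain_of_mem _ ht, d_polygon_apply, map_sum]
    symm
    refine Finset.sum_of_injOn (fun f => ⟨f.1.castSucc, State.mem_contract.1 f.2⟩) ?_ ?_ ?_ ?_
    · exact fun f _ g _ h =>
        Subtype.ext (Fin.castSucc_injective _ (congrArg (fun x => x.1) h))
    · exact fun _ _ => Finset.mem_coe.2 (Finset.mem_univ _)
    · rintro ⟨f, hf⟩ - hf'
      induction f using Fin.lastCases with
      | last =>
        rw [expandCochain_of_notMem, map_zero, smul_zero]
        exact Finset.notMem_erase _ _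
      | cast f => exact (hf' ⟨⟨f, State.mem_contract.2 hf⟩, by simp, rfl⟩).elim
    · rintro ⟨f, hf⟩ -
      have hft := State.mem_contract.1 hf
      have hlast : Fin.last (n + 1) ∈ (t.erase ⟨f.castSucc, hft⟩).1 :=
        Finset.mem_erase.2 ⟨(Fin.castSucc_ne_last f).symm, ht⟩
      have hcard : ((t.contract ht).1.filter (· < f)).card =
          (t.1.filter (· < f.castSucc)).card := by
        rw [← Finset.card_map Fin.castSuccEmb]
        congr 1
        ext g
        induction g using Fin.lastCases with
        | last => simp [Fin.castSucc_ne_last, Fin.le_last]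
        | cast g => simp [State.mem_contract]
      have hstate : (t.contract ht).erase ⟨f, hf⟩ =
          (t.erase ⟨f.castSucc, hft⟩).contract hlast := by
        refine Subtype.ext (Finset.ext fun g => Iff.trans ?_ State.mem_contract.symm)
        simp only [State.erase, Finset.mem_erase, State.mem_contract, ne_eq, Fin.castSucc_inj]
      have hc1 : Compatible Fin.castSucc ((t.contract ht).erase ⟨f, hf⟩).1 t.1 :=
        compatible_castSucc ht fun g hg => State.mem_contract.1 (Finset.mem_of_mem_erase hg)
      have hc2 : Compatible Fin.castSucc ((t.erase ⟨f.castSucc, hft⟩).contract hlast).1 t.1 := by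
        rw [← hstate]
        exact hc1
      rw [map_smul, expandCochain_of_mem x hlast, hcard]
      congr 1
      refine Eq.trans (push_push R A _ _ hc1 ?_ _) (Eq.trans (push_cochain_congr x hstate hc1 hc2)
        (Eq.symm (push_push R A _ _ hc2 ?_ _)))
      exacts [fun _ => rfl, fun _ => rfl]
  · rw [expandCochain_of_notMem _ ht]
    refine Finset.sum_eq_zero fun f _ => ?_
    rw [expandCochain_of_notMem, map_zero, smul_zero]
    exact fun h => ht (Finset.mem_of_mem_erase h)

/-- A cochain of `P_{n+2}` of positive height that is closed on the states without the last edge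
comes from `P_{n+1}` up to a coboundary. -/
theorem exists_eq_d_add_expandCochain (𝒜 : ℕ → Submodule R A) [GradedAlgebra 𝒜] {i : ℕ}
    (z : Cochain R A (polygon (n + 2)) (i + 1))
    (hz : ∀ t, Fin.last (n + 1) ∉ t.1 → d R A (polygon (n + 2)) (i + 1) z t = 0) :
    ∃ (w : Cochain R A (polygon (n + 2)) i) (x : Cochain R A (polygon (n + 1)) i),
      z = d R A (polygon (n + 2)) i w + expandCochain R A n i x ∧
      ∀ j, z ∈ cochainDegree 𝒜 (polygon (n + 2)) (i + 1) j →
        x ∈ cochainDegree 𝒜 (polygon (n + 1)) i j := by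
  obtain ⟨w, hw, hdw⟩ := exists_primitive 𝒜 (n + 1) le_rfl z fun t ht =>
    hz t fun h => (ht _ h).false
  refine ⟨w, contractCochain R A n i (z - d R A (polygon (n + 2)) i w), ?_, fun j hj =>
    contractCochain_mem 𝒜 (sub_mem hj (d_mem_cochainDegree 𝒜 (hw j hj)))⟩
  rw [expandCochain_contractCochain, add_sub_cancel]
  intro t ht
  rw [Pi.sub_apply, sub_eq_zero, hdw]
  exact fun f hf => Fin.val_lt_last fun h => ht (h ▸ hf)

variable (R A) in
/-- The map of cocycles induced by `expandCochain`. -/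
def expandCocycle (n i : ℕ) :
    cocycles R A (polygon (n + 1)) i →ₗ[R] cocycles R A (polygon (n + 2)) (i + 1) :=
  (expandCochain R A n i).restrict fun x hx => by
    rw [cocycles, LinearMap.mem_ker] at hx ⊢
    rw [d_expandCochain, hx, map_zero]

/-- `H^{i+1}(P_{n+1}) ≅ H^{i+2}(P_{n+2})` as graded modules. -/
theorem gradedIso_polygon_succ (𝒜 : ℕ → Submodule R A) [GradedAlgebra 𝒜] (n i : ℕ) :
    GradedIso 𝒜 (polygon (n + 1)) (i + 1) (polygon (n + 2)) (i + 2) := by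
  have hle : (coboundaries R A (polygon (n + 1)) (i + 1)).submoduleOf
      (cocycles R A (polygon (n + 1)) (i + 1)) ≤
      ((coboundaries R A (polygon (n + 2)) (i + 2)).submoduleOf
        (cocycles R A (polygon (n + 2)) (i + 2))).comap (expandCocycle R A n (i + 1)) := by
    rintro ⟨x, hx⟩ ⟨y, hy⟩
    exact ⟨expandCochain R A n i y, (d_expandCochain y).trans (congrArg _ hy)⟩
  have hlift (z : cocycles R A (polygon (n + 2)) (i + 2)) :
      ∃ x : cocycles R A (polygon (n + 1)) (i + 1),
        (Submodule.Quotient.mk (expandCocycle R A n (i + 1) x) :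
          Cohomology R A (polygon (n + 2)) (i + 2)) = Submodule.Quotient.mk z ∧
        ∀ j, z.1 ∈ cochainDegree 𝒜 (polygon (n + 2)) (i + 2) j →
          x.1 ∈ cochainDegree 𝒜 (polygon (n + 1)) (i + 1) j := by
    have hz : d R A (polygon (n + 2)) (i + 2) z.1 = 0 := z.2
    obtain ⟨w, x, hzx, hx⟩ := exists_eq_d_add_expandCochain 𝒜 z.1 fun t _ => by rw [hz]; rfl
    -- Applying `d` to `z = d w + expandCochain x` gives `expandCochain (d x) = 0`, so `x` is a
    -- cocycle.
    refine ⟨⟨x, expandCochain_injective _ ?_⟩, ?_, hx⟩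
    · rw [← d_expandCochain, map_zero, ← hz, hzx, map_add, d_d, zero_add]
    · refine Eq.symm ((Submodule.Quotient.eq _).2 ?_)
      refine ⟨w, ?_⟩
      exact eq_sub_of_add_eq hzx.symm
  let Φ : Cohomology R A (polygon (n + 1)) (i + 1) →ₗ[R]
      Cohomology R A (polygon (n + 2)) (i + 2) := Submodule.mapQ _ _ _ hle
  have hinj : Function.Injective Φ := by
    rw [← LinearMap.ker_eq_bot, LinearMap.ker_eq_bot']
    intro c hc
    obtain ⟨x, rfl⟩ := Submodule.Quotient.mk_surjective _ c
    obtain ⟨y, hy⟩ := (Submodule.Quotient.mk_eq_zero _).1 hc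
    replace hy : d R A (polygon (n + 2)) (i + 1) y = expandCochain R A n (i + 1) x.1 := hy
    -- The primitive `y` has height `i + 1 > 0` and `d y` vanishes off the last edge, so `y` can be
    -- replaced by an expanded cochain `u` with the same differential. This is where the source must
    -- have positive height.
    obtain ⟨w, u, hyu, -⟩ := exists_eq_d_add_expandCochain 𝒜 y fun t ht => by
      rw [hy, expandCochain_of_notMem _ ht]
    refine (Submodule.Quotient.mk_eq_zero _).2 ⟨u, expandCochain_injective _ ?_⟩
    rw [← d_expandCochain]
    refine Eq.trans ?_ hy
    rw [hyu, map_add, d_d, zero_add]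
  have hsurj : Function.Surjective Φ := fun c => by
    obtain ⟨z, rfl⟩ := Submodule.Quotient.mk_surjective _ c
    obtain ⟨x, hx, -⟩ := hlift z
    exact ⟨Submodule.Quotient.mk x, hx⟩
  refine ⟨LinearEquiv.ofBijective Φ ⟨hinj, hsurj⟩, fun j => le_antisymm ?_ ?_⟩
  · rintro _ ⟨_, ⟨x, hx, rfl⟩, rfl⟩
    exact ⟨expandCocycle R A n (i + 1) x, expandCochain_mem 𝒜 hx, rfl⟩
  · rintro _ ⟨z, hz, rfl⟩
    -- The lift of a homogeneous cocycle is homogeneous of the same degree, so the image fills the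
    -- whole degree `j` part.
    obtain ⟨x, hx, hdeg⟩ := hlift z
    exact ⟨Submodule.Quotient.mk x, ⟨x, hdeg j hz, rfl⟩, hx⟩

theorem gradedIso_polygon_one (𝒜 : ℕ → Submodule R A) [GradedAlgebra 𝒜] (i m : ℕ) :
    GradedIso 𝒜 (polygon (m + 1 + i)) (i + 1) (polygon (m + 1)) 1 := by
  induction i with
  | zero => exact .refl 𝒜 _ _
  | succ i ih =>
    have h := (gradedIso_polygon_succ 𝒜 (m + i) i).symm
    rw [show m + i + 1 = m + 1 + i by omega, show m + i + 2 = m + 1 + (i + 1) by omega] at h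
    exact h.trans ih

end Contract

end

end GraphCohomology

theorem mainTheorem6 {A : Type*} [CommRing A] (𝒜 : ℕ → Submodule ℤ A) [GradedAlgebra 𝒜]
    (hfree : ∀ j, Module.Free ℤ (𝒜 j)) (hfin : ∀ j, Module.Finite ℤ (𝒜 j)) :
    (∀ n i : ℕ, 1 ≤ n → 1 ≤ i →
      GraphCohomology.GradedIso 𝒜 (GraphCohomology.polygon (n + 1)) (i + 1)
        (GraphCohomology.polygon n) i) ∧
    (∀ n i : ℕ, 1 ≤ n → 1 ≤ i → i ≤ n →
      GraphCohomology.GradedIso 𝒜 (GraphCohomology.polygon n) i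
        (GraphCohomology.polygon (n - i + 1)) 1) ∧
    (∀ n i : ℕ, 1 ≤ n → n < i →
      Subsingleton (GraphCohomology.Cohomology ℤ A (GraphCohomology.polygon n) i)) := by
  refine ⟨fun n i hn hi => ?_, fun n i _ hi hin => ?_, fun n i _ hin => ?_⟩
  · obtain ⟨n, rfl⟩ := Nat.exists_eq_add_of_le' hn
    obtain ⟨i, rfl⟩ := Nat.exists_eq_add_of_le' hi
    exact (GraphCohomology.gradedIso_polygon_succ 𝒜 n i).symm
  · obtain ⟨i, rfl⟩ := Nat.exists_eq_add_of_le' hi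
    obtain ⟨m, rfl⟩ := Nat.exists_eq_add_of_le' hin
    rw [Nat.add_sub_cancel, show m + (i + 1) = m + 1 + i by omega]
    exact GraphCohomology.gradedIso_polygon_one 𝒜 i m
  · exact GraphCohomology.subsingleton_cohomology_of_card_lt _ i (by simpa using hin)
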